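/- **Model.** Let $M=[m]$ be a set of $m$ indivisible items and let there be $n$ players. A (general) valuation is a function $v:2^M\to\mathbb R_{\ge 0}$ that is monotone ($S\subseteq T$ implies $v(S)\le v(T)$), with $v(\emptyset)=0$ and $v(M)>0$. An allocation is an ordered partition $(A_1,\dots,A_n)$ of $M$ (empty bundles allowed); for $c\in[0,1]$ it is $c$-Prop if $v_i(A_i)\ge c\cdot v_i(M)/n$ for every player $i$. Player $i$ knows only $v_i$. In a deterministic protocol the bits sent so far determine which player acts next and whether she broadcasts one bit or ends the protocol by declaring an answer; the bit or the answer is a function of her own valuation and of the bits sent so far. A public-coin randomized protocol may in addition depend on an infinite stream of independent fair random bits per player, all of them seen by all players (the answer on each input being a random variable). Its communication cost is the number of bits sent (the final declaration is not counted) in the worst case over valuations and random bits. It *determines whether a $c$-Prop allocation exists* if for every valuation profile it declares the correct yes/no answer with probability at least $2/3$. $R(n,m,\mathrm{Prop},c)$ is the minimum cost of a randomized protocol that, for every valuation profile, with probability at least $2/3$ declares a $c$-Prop allocation if one exists and declares that there is none otherwise. **Theorem.** There is a constant $\delta>0$ such that for all $c\in(0,1]$ and all integers $k\ge 1$: every randomized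 protocol that determines, for two players with general valuations on $2k$ items, whether a $c$-Prop allocation exists has communication cost at least $\delta\binom{2k}{k}$; and also $$R(2,2k,\mathrm{Prop},c)\ \ge\ \delta\binom{2k}{k}.$$ In particular, $R(2,2k,\mathrm{Prop},c)\in\Omega\big(\binom{2k}{k}\big)$ for every $c\in(0,1]$. With the same $\delta$, both bounds remain true for protocols that only have to handle valuations all of whose values lie in a prescribed set $D\subseteq\mathbb R_{\ge0}$ with $0,1\in D$ (for instance, the integers of at most $b$ bits, for any $b\ge1$). -/

import Mathlib

open MeasureTheory
open scoped NNReal ENNReal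

namespace FairDivision

/-- A general valuation on the items `Fin m`: a monotone, normalized function on bundles giving
positive value to the set of all items. All values lie in the set `D` of representable values;
`D = Set.univ` imposes no restriction. -/
structure Valuation (m : ℕ) (D : Set ℝ≥0) where
  val : Finset (Fin m) → ℝ≥0
  mono : ∀ ⦃S T : Finset (Fin m)⦄, S ⊆ T → val S ≤ val T
  val_empty : val ∅ = 0
  val_univ_pos : 0 < val Finset.univ
  mem_values : ∀ S, val S ∈ D

/-- A valuation profile: one valuation for each of the `n` players. -/
abbrev Profile (n m : ℕ) (D : Set ℝ≥0) : Type := Fin n → Valuation m D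

/-- An allocation of the items `Fin m` to the players `Fin n`, given by the owner of each item. -/
abbrev Allocation (n m : ℕ) : Type := Fin m → Fin n

/-- The bundle that player `i` receives. -/
def Allocation.bundle {n m : ℕ} (A : Allocation n m) (i : Fin n) : Finset (Fin m) :=
  Finset.univ.filter (fun g => A g = i)

/-- `A` is `c`-Prop: `v_i(A_i) ≥ c * v_i(M) / n` for each player `i`. -/
def IsProp {n m : ℕ} {D : Set ℝ≥0} (c : ℝ) (v : Profile n m D) (A : Allocation n m) : Prop :=
  ∀ i : Fin n, c * (((v i).val Finset.univ : ℝ) / (n : ℝ)) ≤ ((v i).val (A.bundle i) : ℝ)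

/-- Deterministic protocols for players `Fin n` with private inputs in `X` and answers in `O`.
At `speak i msg next`, player `i` broadcasts the bit `msg x`, where `x` is her private input, and the
protocol goes on with `next` of that bit. At `declare i ans`, player `i` ends the protocol by
declaring the answer `ans x`. So who acts, and what she does as a function of her own input, is
determined by the bits sent so far. -/
inductive Protocol (n : ℕ) (X O : Type) : Type
  | declare (i : Fin n) (ans : X → O) : Protocol n X O
  | speak (i : Fin n) (msg : X → Bool) (next : Bool → Protocol n X O) : Protocol n X O

namespace Protocol

variable {n : ℕ} {X O : Type}

/-- The answer declared on the input profile `x`. -/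
def answer : Protocol n X O → (Fin n → X) → O
  | declare i ans, x => ans (x i)
  | speak i msg next, x => answer (next (msg (x i))) x

/-- The number of bits sent on the input profile `x`; the final declaration is not counted. -/
def bits : Protocol n X O → (Fin n → X) → ℕ
  | declare _ _, _ => 0
  | speak i msg next, x => bits (next (msg (x i))) x + 1

end Protocol

/-- The random bits: an infinite stream for each player. -/
abbrev Coins (n : ℕ) : Type := Fin n × ℕ → Bool

/-- The law of the random bits: independent fair coins. -/
noncomputable def coinMeasure (n : ℕ) : Measure (Coins n) :=
  Measure.infinitePi (fun _ : Fin n × ℕ => (PMF.uniformOfFintype Bool).toMeasure)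

/-- Public-coin randomized protocols: all players see all random bits, and once these are fixed
the protocol is deterministic. The answer on each input is required to be a random variable. -/
structure RandomizedProtocol (n : ℕ) (X O : Type) where
  run : Coins n → Protocol n X O
  measurableSet_answer : ∀ (x : Fin n → X) (o : O), MeasurableSet {ω | (run ω).answer x = o}

namespace RandomizedProtocol

variable {n : ℕ} {X O : Type}

/-- The communication cost: the number of bits sent in the worst case over inputs and coins. -/
noncomputable def cost (Γ : RandomizedProtocol n X O) : ℕ∞ :=
  ⨆ (x : Fin n → X) (ω : Coins n), ((Γ.run ω).bits x : ℕ∞)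

/-- On every input the answer is right (in the sense of `right`) with probability at least 2/3. -/
def Computes (Γ : RandomizedProtocol n X O) (right : (Fin n → X) → O → Prop) : Prop :=
  ∀ x : Fin n → X, (2 / 3 : ℝ≥0∞) ≤ coinMeasure n {ω | right x ((Γ.run ω).answer x)}

end RandomizedProtocol

/-- The right answers to the question whether there is a `c`-Prop allocation. -/
def RightDecision {n m : ℕ} {D : Set ℝ≥0} (c : ℝ) (v : Profile n m D) (b : Bool) : Prop :=
  b = true ↔ ∃ A, IsProp c v A

/-- The right answers to the search problem: a `c`-Prop allocation, or `none` if there is none. -/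
def RightSearch {n m : ℕ} {D : Set ℝ≥0} (c : ℝ) (v : Profile n m D) :
    Option (Allocation n m) → Prop
  | some A => IsProp c v A
  | none => ∀ A, ¬ IsProp c v A

/-- The randomized communication complexity `R(n, m, Prop, c)`: the least cost of a randomized
protocol that finds a `c`-Prop allocation or shows that there is none, for `n` players and `m`
items, with valuations whose values lie in `D`. -/
noncomputable def randomizedComplexity (D : Set ℝ≥0) (n m : ℕ) (c : ℝ) : ℕ∞ :=
  ⨅ (Γ : RandomizedProtocol n (Valuation m D) (Option (Allocation n m)))
    (_ : Γ.Computes (RightSearch c)), Γ.cost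

end FairDivision

/-!
The second player values exactly the complements of the half bundles in her family `y`, the first
player exactly the half bundles in her family `x`, and both value every larger bundle. A fair
allocation then exists if and only if `x` and `y` meet, so deciding set disjointness for subsets of
the half bundles reduces to deciding fair division.

For set disjointness on `ι`, split a uniform `z : ι → Bool` along a random `d : ι → Bool`: the
players receive `d ⊓ z` and `dᶜ ⊓ z`, which are independent and disjoint. A transcript of `b` bits
reveals `O(b)` bits of information about `z`, so by the level-one inequality it biases an average
coordinate `i` by `O(b / |ι|)` in the squared sense. Hence changing coordinate `i` of one player
moves the distribution of the transcript little in Hellinger distance. As the fibres of the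
transcript are rectangles, cutting and pasting shows that setting coordinate `i` of both players,
which makes the inputs meet, also moves it little. A correct protocol must tell these cases apart,
so `b` is linear in `|ι|`.
-/

namespace Disjointness

open Finset Function Real
open scoped BigOperators

section Cube

variable {ι : Type*}

/-- The sign `±1` of a bit, so that the coordinates of a uniform point of the cube become
independent random signs. -/
def sign (b : Bool) : ℝ := bif b then 1 else -1

lemma expect_ite_eq_half_sub {α : Type*} [Fintype α] [Nonempty α] (A : α → Bool → Bool) :
    𝔼 p : α × Bool, (if A p.1 p.2 = p.2 then (1 : ℝ) else 0)
      = 1 / 2 - (𝔼 a, (sign (A a false) - sign (A a true))) / 4 := by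
  have pointwise (a) : 𝔼 e, (if A a e = e then (1 : ℝ) else 0)
      = 1 / 2 - (sign (A a false) - sign (A a true)) / 4 := by
    rw [Fintype.expect_eq_sum_div_card, Fintype.sum_bool, Fintype.card_bool]
    cases A a false <;> cases A a true <;> norm_num [sign]
  simp only [← univ_product_univ, expect_product, pointwise]
  rw [expect_sub_distrib, Fintype.expect_const, expect_div]

lemma inf_update [DecidableEq ι] (d z : ι → Bool) (i : ι) (c : Bool) :
    d ⊓ update z i c = update (d ⊓ z) i (d i ⊓ c) := by
  ext j
  obtain rfl | hj := eq_or_ne j i <;> simp [*]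

lemma update_inf_update [DecidableEq ι] (d z : ι → Bool) (i : ι) (b c : Bool) :
    update (update d i b ⊓ z) i c = update (d ⊓ z) i c := by
  ext j
  obtain rfl | hj := eq_or_ne j i <;> simp [*]

lemma compl_update [DecidableEq ι] (d : ι → Bool) (i : ι) (b : Bool) :
    (update d i b)ᶜ = update dᶜ i bᶜ :=
  comp_update (·ᶜ) d i b

lemma not_disjoint_iff_exists {x y : ι → Bool} :
    ¬ Disjoint x y ↔ ∃ i, x i = true ∧ y i = true := by
  simp [disjoint_iff, funext_iff]

lemma disjoint_update_iff [DecidableEq ι] (d z : ι → Bool) (i : ι) (c : Bool) :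
    Disjoint (update (d ⊓ z) i c) (update (dᶜ ⊓ z) i c) ↔ c = false := by
  have pointwise (j) : Disjoint (update (d ⊓ z) i c j) (update (dᶜ ⊓ z) i c j)
      ↔ (j = i → c = false) := by
    obtain rfl | hj := eq_or_ne j i
    · simp [disjoint_self]
    · cases h : d j <;> simp [disjoint_iff, hj, h]
  simp [Pi.disjoint_iff, pointwise]

lemma exists_forall_disjoint_iff_ne (ι : Type*) [Nontrivial ι] :
    ∃ s : Bool → ι → Bool, ∀ p q, Disjoint (s p) (s q) ↔ p ≠ q := by
  classical
  obtain ⟨i, j, hij⟩ := exists_pair_ne ι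
  refine ⟨fun p k => decide (k = i) == p, fun p q => ⟨?_, fun hpq => Pi.disjoint_iff.2 fun k => ?_⟩⟩
  · rintro h rfl
    have eq_bot := disjoint_self.1 h
    cases p
    · simpa [hij.symm] using congrFun eq_bot j
    · simpa using congrFun eq_bot i
  · obtain rfl := Bool.eq_not.2 hpq
    cases q <;> simp [disjoint_iff]

variable [Fintype ι] [DecidableEq ι]

lemma expect_eq_expect_update (i : ι) (f : (ι → Bool) → ℝ) :
    𝔼 z, f z = (𝔼 z, f (update z i true) + 𝔼 z, f (update z i false)) / 2 := by
  have flip_involutive : Involutive fun z : ι → Bool => update z i (!z i) := fun z => by simp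
  have expect_flip : 𝔼 z, f (update z i (!z i)) = 𝔼 z, f z :=
    Fintype.expect_equiv flip_involutive.toPerm _ _ fun _ => rfl
  have pointwise (z : ι → Bool) :
      f (update z i true) + f (update z i false) = f z + f (update z i (!z i)) := by
    have := update_eq_self i z
    cases h : z i <;> rw [h] at this <;> simp [this, add_comm]
  rw [← expect_add_distrib, expect_congr rfl fun z _ => pointwise z, expect_add_distrib,
    expect_flip]
  ring

/-- Two independent points of the cube become one by swapping their coordinates outside `d`. -/
lemma expect_inf_mul_compl_inf (d : ι → Bool) (F G : (ι → Bool) → ℝ) :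
    𝔼 z, F (d ⊓ z) * G (dᶜ ⊓ z) = (𝔼 z, F (d ⊓ z)) * 𝔼 z, G (dᶜ ⊓ z) := by
  let swap (p : (ι → Bool) × (ι → Bool)) : (ι → Bool) × (ι → Bool) :=
    (d ⊓ p.1 ⊔ dᶜ ⊓ p.2, d ⊓ p.2 ⊔ dᶜ ⊓ p.1)
  have swap_involutive : Involutive swap := fun p => by
    ext j <;> cases h : d j <;> simp [swap, h]
  have inf_swap (p) : d ⊓ (swap p).1 = d ⊓ p.1 := by
    ext j; cases h : d j <;> simp [swap, h]
  have compl_inf_swap (p) : dᶜ ⊓ (swap p).1 = dᶜ ⊓ p.2 := by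
    ext j; cases h : d j <;> simp [swap, h]
  calc 𝔼 z, F (d ⊓ z) * G (dᶜ ⊓ z)
      = 𝔼 p : (ι → Bool) × (ι → Bool), F (d ⊓ p.1) * G (dᶜ ⊓ p.1) := by
        simp only [← univ_product_univ, expect_product, Fintype.expect_const]
    _ = 𝔼 p : (ι → Bool) × (ι → Bool), F (d ⊓ p.1) * G (dᶜ ⊓ p.2) := by
        refine (Fintype.expect_equiv swap_involutive.toPerm _ _ fun p => ?_).symm
        simp only [Involutive.coe_toPerm, inf_swap, compl_inf_swap]
    _ = (𝔼 z, F (d ⊓ z)) * 𝔼 z, G (dᶜ ⊓ z) := by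
        simp only [← univ_product_univ, expect_product, Fintype.expect_mul_expect]

lemma expect_exp_sum_mul_sign_le (w : ι → ℝ) :
    𝔼 z : ι → Bool, exp (∑ i, w i * sign (z i)) ≤ exp (∑ i, w i ^ 2 / 2) := by
  have mgf_eq : 𝔼 z : ι → Bool, exp (∑ i, w i * sign (z i)) = ∏ i, cosh (w i) := by
    simp only [exp_sum, Fintype.expect_eq_sum_div_card, cosh_eq, prod_div_distrib]
    rw [← Fintype.prod_sum fun i b => exp (w i * sign b)]
    simp [sign]
  rw [mgf_eq, exp_sum]
  exact prod_le_prod (fun i _ => (cosh_pos _).le) fun i _ => cosh_le_exp_half_sq _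

/-- Gibbs' variational inequality `log 𝔼 e^W ≥ 𝔼 [f W] / p + log p` for the linear form `W` whose
coefficients are the biases of `f`. -/
lemma sum_sq_expect_sign_mul_div_le (f : (ι → Bool) → ℝ) (hf0 : ∀ z, 0 ≤ f z)
    (hf1 : ∀ z, f z ≤ 1) :
    ∑ i, (𝔼 z, sign (z i) * f z) ^ 2 / 𝔼 z, f z ≤ 2 * negMulLog (𝔼 z, f z) := by
  set p := 𝔼 z, f z with hp
  set s : ι → ℝ := fun i => 𝔼 z, sign (z i) * f z
  rcases (show 0 ≤ p from expect_nonneg fun z _ => hf0 z).eq_or_lt with hp0 | hp0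
  · simp only [← hp0, div_zero, sum_const_zero, negMulLog_zero, mul_zero, le_refl]
  let W (z : ι → Bool) : ℝ := ∑ i, s i / p * sign (z i) - ∑ i, (s i / p) ^ 2 / 2
  have expect_mul_W : 𝔼 z, f z * W z = (∑ i, s i ^ 2 / p) / 2 := by
    have expand (z) : f z * W z
        = ∑ i, (s i / p * (sign (z i) * f z) - (s i / p) ^ 2 / 2 * f z) := by
      rw [sum_sub_distrib, ← sum_mul, mul_sub, mul_sum, mul_comm (f z) (∑ i, _)]
      congr 1
      exact sum_congr rfl fun i _ => by ring
    simp only [expand, expect_sum_comm, expect_sub_distrib, ← mul_expect, sum_div]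
    refine sum_congr rfl fun i _ => ?_
    rw [← hp, ← show s i = 𝔼 z, sign (z i) * f z from rfl]
    field_simp
    ring
  have expect_exp_W : 𝔼 z, exp (W z) ≤ 1 := by
    simp only [W, exp_sub, ← expect_div]
    exact (div_le_one (exp_pos _)).2 (expect_exp_sum_mul_sign_le _)
  have pointwise (z) : f z * (1 + W z + log p) ≤ p * exp (W z) := calc
    f z * (1 + W z + log p) ≤ f z * exp (W z + log p) := by
      gcongr
      · exact hf0 z
      · linarith [add_one_le_exp (W z + log p)]
    _ ≤ 1 * exp (W z + log p) := by gcongr; exact hf1 z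
    _ = p * exp (W z) := by rw [exp_add, exp_log hp0]; ring
  have averaged := expect_le_expect fun z (_ : z ∈ univ) => pointwise z
  simp only [mul_add, mul_one, expect_add_distrib, ← expect_mul, ← mul_expect, expect_mul_W,
    ← hp] at averaged
  rw [negMulLog]
  nlinarith

end Cube

section Hellinger

variable {L : Type*} [Fintype L]

lemma sum_negMulLog_le_log_card {p : L → ℝ} (hp0 : ∀ l, 0 ≤ p l) (hp1 : ∑ l, p l = 1) :
    ∑ l, negMulLog (p l) ≤ log (Fintype.card L) := by
  set N : ℝ := (Fintype.card L : ℝ) with hN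
  have : Nonempty L := by
    by_contra h
    rw [not_nonempty_iff] at h
    simp at hp1
  have hN0 : 0 < N := Nat.cast_pos.2 Fintype.card_pos
  have pointwise (l) : N * (negMulLog (p l) - p l * log N) ≤ 1 - N * p l := calc
    N * (negMulLog (p l) - p l * log N) = negMulLog (N * p l) := by
      rw [negMulLog_mul, negMulLog, negMulLog]; ring
    _ ≤ 1 - N * p l := negMulLog_le_one_sub_self (mul_nonneg hN0.le (hp0 l))
  have summed := sum_le_sum fun l (_ : l ∈ univ) => pointwise l
  simp only [← mul_sum, sum_sub_distrib, ← sum_mul, hp1, sum_const, card_univ, nsmul_eq_mul,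
    ← hN] at summed
  nlinarith

/-- Twice the squared Hellinger distance of two distributions on `L` (the factor `1/2` is left
out). -/
noncomputable def sqHellinger (P Q : L → ℝ) : ℝ := ∑ l, (√(P l) - √(Q l)) ^ 2

lemma sqHellinger_le_two_mul_add (P Q R : L → ℝ) :
    sqHellinger P R ≤ 2 * (sqHellinger P Q + sqHellinger R Q) := by
  simp only [sqHellinger, ← sum_add_distrib, mul_sum]
  exact sum_le_sum fun l _ => by nlinarith [sq_nonneg (√(P l) + √(R l) - 2 * √(Q l))]

/-- The triangular discrimination `(p - q)² / (p + q)` dominates the Hellinger distance. -/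
lemma sq_sqrt_sub_sqrt_le {p q : ℝ} (hp : 0 ≤ p) (hq : 0 ≤ q) :
    (√p - √q) ^ 2 ≤ (p - q) ^ 2 / (p + q) := by
  rcases (add_nonneg hp hq).eq_or_lt with h | h
  · obtain ⟨rfl, rfl⟩ := (add_eq_zero_iff_of_nonneg hp hq).1 h.symm
    simp
  · rw [le_div_iff₀ h]
    calc (√p - √q) ^ 2 * (p + q) ≤ (√p - √q) ^ 2 * (√p + √q) ^ 2 := by
          gcongr
          nlinarith [sq_sqrt hp, sq_sqrt hq, mul_nonneg (sqrt_nonneg p) (sqrt_nonneg q)]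
      _ = (√p ^ 2 - √q ^ 2) ^ 2 := by ring
      _ = (p - q) ^ 2 := by rw [sq_sqrt hp, sq_sqrt hq]

lemma sq_sum_mul_sub_le_sqHellinger {P Q t : L → ℝ} (hP : ∀ l, 0 ≤ P l) (hQ : ∀ l, 0 ≤ Q l)
    (hP1 : ∑ l, P l = 1) (hQ1 : ∑ l, Q l = 1) (ht : ∀ l, |t l| ≤ 1) :
    (∑ l, t l * (P l - Q l)) ^ 2 ≤ 4 * sqHellinger P Q := by
  have factor (l) : t l * (P l - Q l) = (√(P l) - √(Q l)) * (t l * (√(P l) + √(Q l))) := by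
    linear_combination t l * (mul_self_sqrt (hQ l) - mul_self_sqrt (hP l))
  have mass_le : ∑ l, (t l * (√(P l) + √(Q l))) ^ 2 ≤ 4 := calc
    ∑ l, (t l * (√(P l) + √(Q l))) ^ 2 ≤ ∑ l, 2 * (P l + Q l) := by
      refine sum_le_sum fun l _ => ?_
      have sq_t_le : t l ^ 2 ≤ 1 := (sq_le_one_iff_abs_le_one _).2 (ht l)
      calc (t l * (√(P l) + √(Q l))) ^ 2 = t l ^ 2 * (√(P l) + √(Q l)) ^ 2 := mul_pow ..
        _ ≤ 1 * (2 * (√(P l) ^ 2 + √(Q l) ^ 2)) := by gcongr; exact add_sq_le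
        _ = 2 * (P l + Q l) := by rw [sq_sqrt (hP l), sq_sqrt (hQ l), one_mul]
    _ = 4 := by rw [← mul_sum, sum_add_distrib, hP1, hQ1]; norm_num
  calc (∑ l, t l * (P l - Q l)) ^ 2
      = (∑ l, (√(P l) - √(Q l)) * (t l * (√(P l) + √(Q l)))) ^ 2 := by simp only [factor]
    _ ≤ sqHellinger P Q * ∑ l, (t l * (√(P l) + √(Q l))) ^ 2 := sum_mul_sq_le_sq_mul_sq _ _ _
    _ ≤ sqHellinger P Q * 4 := by gcongr; exact sum_nonneg fun l _ => sq_nonneg _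
    _ = 4 * sqHellinger P Q := mul_comm _ _

lemma sqHellinger_eq_sum_sub {P Q : L → ℝ} (hP : ∀ l, 0 ≤ P l) (hQ : ∀ l, 0 ≤ Q l) :
    sqHellinger P Q = ∑ l, P l + ∑ l, Q l - 2 * ∑ l, √(P l * Q l) := by
  rw [sqHellinger, mul_sum, ← sum_add_distrib, ← sum_sub_distrib]
  refine sum_congr rfl fun l _ => ?_
  rw [sqrt_mul (hP l), sub_sq, sq_sqrt (hP l), sq_sqrt (hQ l)]
  ring

/-- The Hellinger affinity of `a₀ b₀` and `a₁ b₁` is that of `a₁ b₀` and `a₀ b₁`: both are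
`∑ √(a₀ a₁ b₀ b₁)`. -/
lemma sqHellinger_cut_paste {a b : Bool → L → ℝ} (ha : ∀ c l, 0 ≤ a c l)
    (hb : ∀ c l, 0 ≤ b c l) (hab : ∀ c e, ∑ l, a c l * b e l = 1) :
    sqHellinger (fun l => a false l * b false l) (fun l => a true l * b true l)
      = sqHellinger (fun l => a true l * b false l) (fun l => a false l * b true l) := by
  have nonneg (c e l) : 0 ≤ a c l * b e l := mul_nonneg (ha c l) (hb e l)
  rw [sqHellinger_eq_sum_sub (nonneg _ _) (nonneg _ _),
    sqHellinger_eq_sum_sub (nonneg _ _) (nonneg _ _), hab, hab, hab, hab]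
  congr! 4 with l
  ring

end Hellinger

lemma sq_expect_le_expect_sq {α : Type*} [Fintype α] [Nonempty α] (f : α → ℝ) :
    (𝔼 a, f a) ^ 2 ≤ 𝔼 a, f a ^ 2 := by
  simpa using expect_mul_sq_le_sq_mul_sq univ f 1

/-- A resolution of the constant `1` on `α × β` into nonnegative product functions indexed by `L`.
It describes how likely each transcript `l` of a two-player protocol is on each pair of inputs; for
a deterministic protocol the products are the indicators of its rectangles. -/
structure ProductPartition (α β L : Type*) [Fintype L] where
  left : L → α → ℝ
  right : L → β → ℝ
  left_nonneg : ∀ l x, 0 ≤ left l x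
  right_nonneg : ∀ l y, 0 ≤ right l y
  sum_left_mul_right : ∀ x y, ∑ l, left l x * right l y = 1

section SectionMean

variable {ι : Type*} [Fintype ι] [DecidableEq ι]

/-- The mean of `F` over the points supported in `d`, with coordinate `i` fixed to `c`. -/
noncomputable def sectionMean (F : (ι → Bool) → ℝ) (d : ι → Bool) (i : ι) (c : Bool) : ℝ :=
  𝔼 z, F (update (d ⊓ z) i c)

lemma sectionMean_nonneg {F : (ι → Bool) → ℝ} (hF : ∀ z, 0 ≤ F z) (d : ι → Bool) (i : ι)
    (c : Bool) : 0 ≤ sectionMean F d i c :=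
  expect_nonneg fun _ _ => hF _

lemma sectionMean_update (F : (ι → Bool) → ℝ) (d : ι → Bool) (i : ι) (b c : Bool) :
    sectionMean F (update d i b) i c = sectionMean F d i c := by
  simp only [sectionMean, update_inf_update]

lemma expect_update_mul_update (F G : (ι → Bool) → ℝ) (d : ι → Bool) (i : ι) (c e : Bool) :
    𝔼 z, F (update (d ⊓ z) i c) * G (update (dᶜ ⊓ z) i e)
      = sectionMean F d i c * sectionMean G dᶜ i e :=
  expect_inf_mul_compl_inf d (fun z => F (update z i c)) fun z => G (update z i e)

lemma expect_apply_mul_inf_mul_compl_inf (h : Bool → ℝ) (F G : (ι → Bool) → ℝ)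
    (d : ι → Bool) (i : ι) :
    𝔼 z, h (z i) * (F (d ⊓ z) * G (dᶜ ⊓ z))
      = (h true * (sectionMean F d i (d i) * sectionMean G dᶜ i (d i)ᶜ)
        + h false * (sectionMean F d i false * sectionMean G dᶜ i false)) / 2 := by
  rw [expect_eq_expect_update i]
  simp only [update_self, inf_update, ← mul_expect, expect_update_mul_update, Pi.compl_apply]
  simp

end SectionMean

namespace ProductPartition

variable {ι L : Type*} [Fintype L]
  (R : ProductPartition (ι → Bool) (ι → Bool) L)

/-- The probability of the transcript `l` when the players receive the parts of `z` inside and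
outside `d`. -/
def leafWeight (d : ι → Bool) (l : L) (z : ι → Bool) : ℝ :=
  R.left l (d ⊓ z) * R.right l (dᶜ ⊓ z)

lemma leafWeight_nonneg (d : ι → Bool) (l : L) (z : ι → Bool) : 0 ≤ R.leafWeight d l z :=
  mul_nonneg (R.left_nonneg _ _) (R.right_nonneg _ _)

lemma sum_leafWeight (d z : ι → Bool) : ∑ l, R.leafWeight d l z = 1 :=
  R.sum_left_mul_right _ _

variable [Fintype ι] [DecidableEq ι]

/-- The squared bias of the coordinate `i` of a uniform point `z` given the transcript on the parts
of `z` inside and outside `d`, averaged over the transcripts. -/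
noncomputable def bias (d : ι → Bool) (i : ι) : ℝ :=
  ∑ l, (𝔼 z, sign (z i) * R.leafWeight d l z) ^ 2 / 𝔼 z, R.leafWeight d l z

lemma sum_bias_le (d : ι → Bool) : ∑ i, R.bias d i ≤ 2 * log (Fintype.card L) := by
  have leafWeight_le_one (l z) : R.leafWeight d l z ≤ 1 :=
    (single_le_sum (fun l _ => R.leafWeight_nonneg d l z) (mem_univ l)).trans_eq
      (R.sum_leafWeight d z)
  calc ∑ i, R.bias d i
      = ∑ l, ∑ i, (𝔼 z, sign (z i) * R.leafWeight d l z) ^ 2 / 𝔼 z, R.leafWeight d l z := sum_comm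
    _ ≤ ∑ l, 2 * negMulLog (𝔼 z, R.leafWeight d l z) := sum_le_sum fun l _ =>
        sum_sq_expect_sign_mul_div_le _ (R.leafWeight_nonneg d l) (leafWeight_le_one l)
    _ ≤ 2 * log (Fintype.card L) := by
        rw [← mul_sum]
        gcongr
        refine sum_negMulLog_le_log_card (fun l => expect_nonneg fun z _ =>
          R.leafWeight_nonneg d l z) ?_
        simp only [← expect_sum_comm, sum_leafWeight, Fintype.expect_const]

/-- The distribution of the transcript when each player gets a random part of her side of `d`, but
coordinate `i` is `c` for the left and `e` for the right player. -/
noncomputable def leafDist (d : ι → Bool) (i : ι) (c e : Bool) (l : L) : ℝ :=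
  sectionMean (R.left l) d i c * sectionMean (R.right l) dᶜ i e

lemma leafDist_nonneg (d : ι → Bool) (i : ι) (c e : Bool) (l : L) : 0 ≤ R.leafDist d i c e l :=
  mul_nonneg (sectionMean_nonneg (R.left_nonneg l) ..) (sectionMean_nonneg (R.right_nonneg l) ..)

lemma leafDist_update (d : ι → Bool) (i : ι) (b : Bool) :
    R.leafDist (update d i b) i = R.leafDist d i := by
  ext c e l
  simp only [leafDist, compl_update, sectionMean_update]

lemma sum_mul_leafDist (t : L → ℝ) (d : ι → Bool) (i : ι) (c e : Bool) :
    ∑ l, t l * R.leafDist d i c e l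
      = 𝔼 z, ∑ l, t l * (R.left l (update (d ⊓ z) i c) * R.right l (update (dᶜ ⊓ z) i e)) := by
  simp only [expect_sum_comm, ← mul_expect, expect_update_mul_update, leafDist]

lemma sum_leafDist (d : ι → Bool) (i : ι) (c e : Bool) : ∑ l, R.leafDist d i c e l = 1 := by
  simpa [R.sum_left_mul_right] using R.sum_mul_leafDist (fun _ => 1) d i c e

lemma sqHellinger_leafDist_le_bias (d : ι → Bool) (i : ι) :
    sqHellinger (R.leafDist d i (d i) (d i)ᶜ) (R.leafDist d i false false) ≤ 2 * R.bias d i := by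
  rw [sqHellinger, bias, mul_sum]
  refine sum_le_sum fun l _ => ?_
  set P := R.leafDist d i (d i) (d i)ᶜ l
  set Q := R.leafDist d i false false l
  have mean_eq : 𝔼 z, R.leafWeight d l z = (P + Q) / 2 := by
    simpa only [P, Q, leafWeight, leafDist, one_mul] using
      expect_apply_mul_inf_mul_compl_inf (fun _ => 1) (R.left l) (R.right l) d i
  have signed_mean_eq : 𝔼 z, sign (z i) * R.leafWeight d l z = (P - Q) / 2 := by
    simpa only [P, Q, leafWeight, leafDist, sign, cond_true, cond_false, one_mul, neg_one_mul,
      ← sub_eq_add_neg] using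
      expect_apply_mul_inf_mul_compl_inf sign (R.left l) (R.right l) d i
  calc (√P - √Q) ^ 2 ≤ (P - Q) ^ 2 / (P + Q) :=
        sq_sqrt_sub_sqrt_le (R.leafDist_nonneg ..) (R.leafDist_nonneg ..)
    _ = 2 * ((𝔼 z, sign (z i) * R.leafWeight d l z) ^ 2 / 𝔼 z, R.leafWeight d l z) := by
        rw [mean_eq, signed_mean_eq, div_pow, div_div_eq_mul_div]
        ring

/-- The difference between the means of the test `t` of the transcript on random disjoint inputs and
on random inputs that meet exactly in `i`. -/
noncomputable def advantage (t : L → ℝ) (d : ι → Bool) (i : ι) : ℝ :=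
  ∑ l, t l * (R.leafDist d i false false l - R.leafDist d i true true l)

/-- Cutting and pasting turns the disjoint pair and the pair meeting in `i` into two pairs that both
differ from the disjoint pair in a single coordinate of a single player. -/
lemma sq_advantage_le_bias {t : L → ℝ} (ht : ∀ l, |t l| ≤ 1) (d : ι → Bool) (i : ι) :
    R.advantage t d i ^ 2 ≤ 16 * (R.bias (update d i true) i + R.bias (update d i false) i) := by
  have left_le := R.sqHellinger_leafDist_le_bias (update d i true) i
  have right_le := R.sqHellinger_leafDist_le_bias (update d i false) i
  simp only [leafDist_update, update_self, Bool.compl_eq_bnot, Bool.not_true,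
    Bool.not_false] at left_le right_le
  calc R.advantage t d i ^ 2
      ≤ 4 * sqHellinger (R.leafDist d i false false) (R.leafDist d i true true) :=
        sq_sum_mul_sub_le_sqHellinger (R.leafDist_nonneg d i _ _) (R.leafDist_nonneg d i _ _)
          (R.sum_leafDist ..) (R.sum_leafDist ..) ht
    _ = 4 * sqHellinger (R.leafDist d i true false) (R.leafDist d i false true) := by
        congr 1
        exact sqHellinger_cut_paste
          (fun c l => sectionMean_nonneg (R.left_nonneg l) d i c)
          (fun e l => sectionMean_nonneg (R.right_nonneg l) dᶜ i e) (R.sum_leafDist d i)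
    _ ≤ 4 * (2 * (sqHellinger (R.leafDist d i true false) (R.leafDist d i false false)
          + sqHellinger (R.leafDist d i false true) (R.leafDist d i false false))) := by
        gcongr
        exact sqHellinger_le_two_mul_add ..
    _ ≤ 16 * (R.bias (update d i true) i + R.bias (update d i false) i) := by linarith

theorem card_mul_sq_expect_advantage_le_log_card {t : L → ℝ} (ht : ∀ l, |t l| ≤ 1) :
    Fintype.card ι * (𝔼 i, 𝔼 d, R.advantage t d i) ^ 2 ≤ 64 * log (Fintype.card L) := by
  have sq_mean_advantage_le (i : ι) : (𝔼 d, R.advantage t d i) ^ 2 ≤ 32 * 𝔼 d, R.bias d i := calc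
    (𝔼 d, R.advantage t d i) ^ 2 ≤ 𝔼 d, R.advantage t d i ^ 2 := sq_expect_le_expect_sq _
    _ ≤ 𝔼 d, 16 * (R.bias (update d i true) i + R.bias (update d i false) i) :=
        expect_le_expect fun d _ => R.sq_advantage_le_bias ht d i
    _ = 32 * 𝔼 d, R.bias d i := by
        rw [expect_eq_expect_update i fun d => R.bias d i, ← mul_expect, expect_add_distrib]
        ring
  rcases isEmpty_or_nonempty ι with _ | _
  · simpa using log_natCast_nonneg _
  calc Fintype.card ι * (𝔼 i, 𝔼 d, R.advantage t d i) ^ 2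
      ≤ Fintype.card ι * 𝔼 i, (𝔼 d, R.advantage t d i) ^ 2 := by
        gcongr
        exact sq_expect_le_expect_sq _
    _ = ∑ i, (𝔼 d, R.advantage t d i) ^ 2 := Fintype.card_mul_expect _
    _ ≤ ∑ i, 32 * 𝔼 d, R.bias d i := sum_le_sum fun i _ => sq_mean_advantage_le i
    _ = 32 * 𝔼 d, ∑ i, R.bias d i := by rw [← mul_sum, expect_sum_comm]
    _ ≤ 32 * (2 * log (Fintype.card L)) := by
        gcongr
        exact expect_le univ_nonempty fun d _ => R.sum_bias_le d
    _ = 64 * log (Fintype.card L) := by ring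

end ProductPartition

section Rectangles

variable {α β L : Type*}

open Classical in
lemma ite_exists_mul_ite_exists {g : α → β → L}
    (hg : ∀ x y x' y', g x y = g x' y' → g x y' = g x y) (x : α) (y : β) (l : L) :
    (if ∃ y', g x y' = l then (1 : ℝ) else 0) * (if ∃ x', g x' y = l then 1 else 0)
      = if g x y = l then 1 else 0 := by
  have mem_rectangle : g x y = l ↔ (∃ y', g x y' = l) ∧ ∃ x', g x' y = l := by
    refine ⟨fun h => ⟨⟨y, h⟩, x, h⟩, ?_⟩
    rintro ⟨⟨y', hy'⟩, x', hx'⟩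
    exact (hg _ _ _ _ (hy'.trans hx'.symm)).trans hy'
  simp only [mem_rectangle, ite_zero_mul_ite_zero, one_mul]

variable [Fintype L]

open Classical in
/-- The indicators of the fibres of `g`, provided that these are rectangles. -/
noncomputable def ProductPartition.ofRectangles (g : α → β → L)
    (hg : ∀ x y x' y', g x y = g x' y' → g x y' = g x y) : ProductPartition α β L where
  left l x := if ∃ y, g x y = l then 1 else 0
  right l y := if ∃ x, g x y = l then 1 else 0
  left_nonneg l x := by positivity
  right_nonneg l y := by positivity
  sum_left_mul_right x y := by simp [ite_exists_mul_ite_exists hg]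

lemma ProductPartition.sum_mul_ofRectangles {g : α → β → L}
    (hg : ∀ x y x' y', g x y = g x' y' → g x y' = g x y) (t : L → ℝ) (x : α) (y : β) :
    ∑ l, t l * ((ofRectangles g hg).left l x * (ofRectangles g hg).right l y) = t (g x y) := by
  classical simp [ofRectangles, ite_exists_mul_ite_exists hg]

variable {ι : Type*} [Fintype ι] [DecidableEq ι]

theorem card_mul_sq_expect_sub_le_log_card {g : (ι → Bool) → (ι → Bool) → L}
    (hg : ∀ x y x' y', g x y = g x' y' → g x y' = g x y) {t : L → ℝ} (ht : ∀ l, |t l| ≤ 1) :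
    Fintype.card ι * (𝔼 i, 𝔼 d, 𝔼 z,
      (t (g (update (d ⊓ z) i false) (update (dᶜ ⊓ z) i false))
        - t (g (update (d ⊓ z) i true) (update (dᶜ ⊓ z) i true)))) ^ 2
      ≤ 64 * log (Fintype.card L) := by
  simpa only [ProductPartition.advantage, mul_sub, sum_sub_distrib,
    ProductPartition.sum_mul_leafDist, ProductPartition.sum_mul_ofRectangles, expect_sub_distrib]
    using (ProductPartition.ofRectangles g hg).card_mul_sq_expect_advantage_le_log_card ht

end Rectangles

end Disjointness

namespace FairDivision

open Finset Function Disjointness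
open scoped BigOperators

namespace Protocol

variable {n : ℕ} {X O : Type}

/-- The bits sent, followed by infinitely many copies of the answer, so that transcripts of
different lengths can be compared bit by bit. -/
def transcript : Protocol n X Bool → (Fin n → X) → ℕ → Bool
  | declare i ans, x, _ => ans (x i)
  | speak i msg _, x, 0 => msg (x i)
  | speak i msg next, x, j + 1 => transcript (next (msg (x i))) x j

lemma transcript_eq_answer (P : Protocol n X Bool) {x : Fin n → X} {j : ℕ} (hj : P.bits x ≤ j) :
    P.transcript x j = P.answer x := by
  induction P generalizing j with
  | declare i ans => rfl
  | speak i msg next ih =>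
    obtain _ | j := j
    · simp [bits] at hj
    · exact ih _ (Nat.le_of_succ_le_succ hj)

lemma transcript_eq_of_forall_eq_or_eq (P : Protocol n X Bool) {x y z : Fin n → X} {b : ℕ}
    (hx : P.bits x ≤ b) (hxy : ∀ j ≤ b, P.transcript x j = P.transcript y j)
    (hz : ∀ i, z i = x i ∨ z i = y i) : P.transcript z = P.transcript x := by
  induction P generalizing b with
  | declare i ans =>
    have ans_eq : ans (x i) = ans (y i) := hxy 0 b.zero_le
    funext j
    obtain hi | hi := hz i <;> simp [transcript, hi, ans_eq]
  | speak i msg next ih =>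
    have msg_eq : msg (x i) = msg (y i) := hxy 0 b.zero_le
    have msg_z_eq : msg (z i) = msg (x i) := by obtain hi | hi := hz i <;> simp [hi, msg_eq]
    obtain _ | b := b
    · simp [bits] at hx
    have tail_eq := ih (msg (x i)) (Nat.le_of_succ_le_succ hx) fun j hj => by
      simpa [transcript, msg_eq] using hxy (j + 1) (Nat.succ_le_succ hj)
    funext j
    obtain _ | j := j <;> simp [transcript, msg_z_eq, tail_eq]

/-- The first `b + 1` cells of the transcript. -/
def leaf (P : Protocol n X Bool) (b : ℕ) (x : Fin n → X) : Fin (b + 1) → Bool :=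
  fun j => P.transcript x j

lemma leaf_last (P : Protocol n X Bool) {b : ℕ} {x : Fin n → X} (hx : P.bits x ≤ b) :
    P.leaf b x (Fin.last b) = P.answer x :=
  P.transcript_eq_answer hx

lemma leaf_cons_cons (P : Protocol 2 X Bool) {b : ℕ} {x y x' y' : X}
    (hb : P.bits ![x, y] ≤ b) (h : P.leaf b ![x, y] = P.leaf b ![x', y']) :
    P.leaf b ![x, y'] = P.leaf b ![x, y] := by
  have prefix_eq (j) (hj : j ≤ b) : P.transcript ![x, y] j = P.transcript ![x', y'] j :=
    congrFun h ⟨j, Nat.lt_succ_of_le hj⟩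
  funext j
  refine congrFun (P.transcript_eq_of_forall_eq_or_eq hb prefix_eq ?_) j
  simp [Fin.forall_fin_two]

theorem card_le_of_le_expect_answer_eq {ι : Type*} [Fintype ι] [DecidableEq ι] [Nonempty ι]
    {P : Protocol 2 X Bool} {b : ℕ} (hb : ∀ x, P.bits x ≤ b) (V W : (ι → Bool) → X)
    (hP : 2 / 3 ≤ 𝔼 p : (ι × (ι → Bool) × (ι → Bool)) × Bool,
      if P.answer ![V (update (p.1.2.1 ⊓ p.1.2.2) p.1.1 p.2),
        W (update (p.1.2.1ᶜ ⊓ p.1.2.2) p.1.1 p.2)] = p.2 then (1 : ℝ) else 0) :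
    (Fintype.card ι : ℝ) ≤ 144 * (b + 1) := by
  have tradeoff := card_mul_sq_expect_sub_le_log_card (g := fun x y => P.leaf b ![V x, W y])
    (t := fun l => sign (l (Fin.last b))) (fun x y x' y' => P.leaf_cons_cons (hb _))
    fun l => by cases l (Fin.last b) <;> simp [sign]
  rw [expect_ite_eq_half_sub fun (a : ι × (ι → Bool) × (ι → Bool)) e =>
    P.answer ![V (update (a.2.1 ⊓ a.2.2) a.1 e), W (update (a.2.1ᶜ ⊓ a.2.2) a.1 e)]] at hP
  simp only [← univ_product_univ, expect_product] at hP
  simp only [P.leaf_last (hb _), Fintype.card_pi_const, Fintype.card_bool, Nat.cast_pow,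
    Nat.cast_ofNat, Real.log_pow, Nat.cast_add, Nat.cast_one] at tradeoff
  have log_two_le : ((b : ℝ) + 1) * Real.log 2 ≤ (b + 1) * 1 := by
    gcongr
    linarith [Real.log_two_lt_d9]
  set advantage := 𝔼 i : ι, 𝔼 d : ι → Bool, 𝔼 z : ι → Bool,
    (sign (P.answer ![V (update (d ⊓ z) i false), W (update (dᶜ ⊓ z) i false)])
      - sign (P.answer ![V (update (d ⊓ z) i true), W (update (dᶜ ⊓ z) i true)]))
  have advantage_sq_ge : 4 / 9 ≤ advantage ^ 2 := by nlinarith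
  nlinarith [mul_le_mul_of_nonneg_left advantage_sq_ge (Nat.cast_nonneg (α := ℝ) (Fintype.card ι))]

/-- The protocol that declares `f` of the answer of a given protocol. -/
def map {O' : Type} (f : O → O') : Protocol n X O → Protocol n X O'
  | declare i ans => declare i fun x => f (ans x)
  | speak i msg next => speak i msg fun b => map f (next b)

lemma answer_map {O' : Type} (f : O → O') (P : Protocol n X O) (x : Fin n → X) :
    (P.map f).answer x = f (P.answer x) := by
  induction P with
  | declare _ _ => rfl
  | speak _ _ _ ih => exact ih _

lemma bits_map {O' : Type} (f : O → O') (P : Protocol n X O) (x : Fin n → X) :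
    (P.map f).bits x = P.bits x := by
  induction P with
  | declare _ _ => rfl
  | speak _ _ _ ih => exact congrArg (· + 1) (ih _)

/-- A player who hears nothing cannot tell whether her bit equals that of the other player. -/
lemma expect_answer_eq_decide_eq {P : Protocol 2 X Bool} (V W : Bool → X)
    (hP : ∀ x, P.bits x = 0) :
    𝔼 p : Bool × Bool, (if P.answer ![V p.1, W p.2] = decide (p.1 = p.2) then (1 : ℝ) else 0)
      = 1 / 2 := by
  cases P with
  | speak i msg next => simpa [bits] using hP ![V true, W true]
  | declare i ans =>
    simp only [Fintype.expect_eq_sum_div_card, Fintype.sum_prod_type, Fintype.sum_bool, answer]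
    fin_cases i
    · cases h : ans (V true) <;> cases h' : ans (V false) <;> norm_num [h, h']
    · cases h : ans (W true) <;> cases h' : ans (W false) <;> norm_num [h, h']

end Protocol

instance (n : ℕ) : IsProbabilityMeasure (coinMeasure n) := by
  unfold coinMeasure
  infer_instance

lemma exists_le_expect_indicator {Ω J : Type*} [MeasurableSpace Ω] [Fintype J] [Nonempty J]
    (μ : Measure Ω) [IsProbabilityMeasure μ] {E : J → Set Ω} (hE : ∀ j, MeasurableSet (E j))
    {r : ℝ} (hr : ∀ j, r ≤ μ.real (E j)) : ∃ ω, r ≤ 𝔼 j, (E j).indicator 1 ω := by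
  have integrable (j) : Integrable ((E j).indicator (1 : Ω → ℝ)) μ :=
    (integrable_const 1).indicator (hE j)
  have integral_eq : ∫ ω, 𝔼 j, (E j).indicator (1 : Ω → ℝ) ω ∂μ = 𝔼 j, μ.real (E j) := by
    simp only [Fintype.expect_eq_sum_div_card, integral_div,
      integral_finsetSum _ fun j _ => integrable j, integral_indicator_one (hE _)]
  have integrable_expect : Integrable (fun ω => 𝔼 j, (E j).indicator (1 : Ω → ℝ) ω) μ := by
    simp only [Fintype.expect_eq_sum_div_card]
    exact (integrable_finsetSum _ fun j _ => integrable j).div_const _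
  obtain ⟨ω, hω⟩ := exists_integral_le integrable_expect
  exact ⟨ω, (le_expect univ_nonempty fun j _ => hr j).trans (integral_eq.symm.trans_le hω)⟩

namespace RandomizedProtocol

variable {n : ℕ} {X O : Type}

lemma bits_le_cost (Γ : RandomizedProtocol n X O) (ω : Coins n) (x : Fin n → X) :
    ((Γ.run ω).bits x : ℕ∞) ≤ Γ.cost :=
  le_iSup₂ (f := fun (x : Fin n → X) (ω : Coins n) => ((Γ.run ω).bits x : ℕ∞)) x ω

lemma Computes.exists_run [DecidableEq O] {Γ : RandomizedProtocol n X O}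
    {right : (Fin n → X) → O → Prop} (hΓ : Γ.Computes right) {J : Type*} [Fintype J] [Nonempty J]
    (x : J → Fin n → X) (f : J → O) (hf : ∀ j o, right (x j) o → o = f j) :
    ∃ ω, 2 / 3 ≤ 𝔼 j, if (Γ.run ω).answer (x j) = f j then (1 : ℝ) else 0 := by
  have prob_ge (j) : 2 / 3 ≤ (coinMeasure n).real {ω | (Γ.run ω).answer (x j) = f j} := by
    have : 2 / 3 ≤ coinMeasure n {ω | (Γ.run ω).answer (x j) = f j} :=
      (hΓ (x j)).trans (measure_mono fun ω hω => hf j _ hω)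
    simpa [measureReal_def] using ENNReal.toReal_mono (measure_ne_top _ _) this
  obtain ⟨ω, hω⟩ := exists_le_expect_indicator _
    (fun j => Γ.measurableSet_answer (x j) (f j)) prob_ge
  exact ⟨ω, by simpa [Set.indicator_apply] using hω⟩

/-- The decision protocol that answers whether a search protocol declares a solution. -/
def toDecision (Γ : RandomizedProtocol n X (Option O)) : RandomizedProtocol n X Bool where
  run ω := (Γ.run ω).map Option.isSome
  measurableSet_answer x o := by
    have measurableSet_none := Γ.measurableSet_answer x none
    cases o
    · simpa [Protocol.answer_map] using measurableSet_none
    · simpa [Protocol.answer_map, ← Option.ne_none_iff_isSome, Set.compl_ofPred]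
        using measurableSet_none.compl

lemma cost_toDecision (Γ : RandomizedProtocol n X (Option O)) : Γ.toDecision.cost = Γ.cost := by
  simp only [cost, toDecision, Protocol.bits_map]

lemma Computes.toDecision {m : ℕ} {D : Set ℝ≥0} {c : ℝ}
    {Γ : RandomizedProtocol n (Valuation m D) (Option (Allocation n m))}
    (hΓ : Γ.Computes (RightSearch c)) : Γ.toDecision.Computes (RightDecision c) := by
  refine fun v => (hΓ v).trans (measure_mono fun ω (hω : RightSearch c v _) => ?_)
  change RightDecision c v (((Γ.run ω).map Option.isSome).answer v)
  rw [Protocol.answer_map]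
  cases hA : (Γ.run ω).answer v <;> rw [hA] at hω
  · simpa [RightDecision, RightSearch] using hω
  · simpa [RightDecision] using ⟨_, hω⟩

section SetDisjointness

variable {ι : Type*} [Nontrivial ι] {Γ : RandomizedProtocol 2 X Bool}
  {right : (Fin 2 → X) → Bool → Prop}

lemma Computes.cost_ne_zero_of_disjointness (hΓ : Γ.Computes right) (V W : (ι → Bool) → X)
    (hVW : ∀ x y b, right ![V x, W y] b → (b = true ↔ ¬ Disjoint x y)) : Γ.cost ≠ 0 := by
  intro hcost
  obtain ⟨s, disjoint_iff_ne⟩ := exists_forall_disjoint_iff_ne ι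
  obtain ⟨ω, hω⟩ := hΓ.exists_run (fun p : Bool × Bool => ![V (s p.1), W (s p.2)])
    (fun p => decide (p.1 = p.2)) fun p b hb => by
      rw [Bool.eq_iff_iff, hVW _ _ _ hb, disjoint_iff_ne, not_ne_iff, decide_eq_true_iff]
  have bits_eq_zero (x) : (Γ.run ω).bits x = 0 := by simpa [hcost] using Γ.bits_le_cost ω x
  rw [Protocol.expect_answer_eq_decide_eq (fun p => V (s p)) (fun p => W (s p)) bits_eq_zero] at hω
  norm_num at hω

theorem Computes.card_le_mul_cost_of_disjointness [Fintype ι] (hΓ : Γ.Computes right)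
    (V W : (ι → Bool) → X) (hVW : ∀ x y b, right ![V x, W y] b → (b = true ↔ ¬ Disjoint x y)) :
    (Fintype.card ι : ℕ∞) ≤ 288 * Γ.cost := by
  classical
  have cost_ne_zero := hΓ.cost_ne_zero_of_disjointness V W hVW
  cases hcost : Γ.cost with
  | top => simp
  | coe b =>
    have b_pos : 0 < b := Nat.pos_of_ne_zero fun h => cost_ne_zero (by simp [hcost, h])
    obtain ⟨ω, hω⟩ := hΓ.exists_run
      (fun p : (ι × (ι → Bool) × (ι → Bool)) × Bool =>
        ![V (update (p.1.2.1 ⊓ p.1.2.2) p.1.1 p.2), W (update (p.1.2.1ᶜ ⊓ p.1.2.2) p.1.1 p.2)])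
      Prod.snd fun p b hb => by
        rw [Bool.eq_iff_iff, hVW _ _ _ hb, disjoint_update_iff, Bool.not_eq_false]
    have bits_le (x) : (Γ.run ω).bits x ≤ b := by
      exact_mod_cast (Γ.bits_le_cost ω x).trans_eq hcost
    have card_le : (Fintype.card ι : ℝ) ≤ 144 * (b + 1) :=
      Protocol.card_le_of_le_expect_answer_eq bits_le V W hω
    have card_le' : Fintype.card ι ≤ 144 * (b + 1) := by exact_mod_cast card_le
    exact_mod_cast card_le'.trans (by omega : 144 * (b + 1) ≤ 288 * b)

end SetDisjointness

end RandomizedProtocol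

/-- A simple game in the sense of voting theory, with the items as voters: an upper set of winning
bundles. It encodes a valuation with a single positive value. -/
structure SimpleGame (m : ℕ) where
  winning : Set (Finset (Fin m))
  isUpperSet_winning : IsUpperSet winning
  empty_notMem : ∅ ∉ winning
  univ_mem : univ ∈ winning

namespace SimpleGame

variable {m h : ℕ} {D : Set ℝ≥0} {a : ℝ≥0} {c : ℝ}

open Classical in
/-- The valuation that gives the value `a` to the winning bundles. -/
noncomputable def valuation (U : SimpleGame m) (hD : 0 ∈ D) (haD : a ∈ D) (ha : 0 < a) :
    Valuation m D where
  val S := if S ∈ U.winning then a else 0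
  mono S T hST := by
    split_ifs with hS hT
    · exact le_rfl
    · exact absurd (U.isUpperSet_winning hST hS) hT
    · exact ha.le
    · exact le_rfl
  val_empty := if_neg U.empty_notMem
  val_univ_pos := by rwa [if_pos U.univ_mem]
  mem_values S := by split_ifs <;> assumption

/-- The game in which a bundle wins if it has more than `h` items, or exactly `h` items and belongs
to `F`. -/
def threshold (h_pos : 0 < h) (h_lt : h < m) (F : Set (Finset (Fin m))) : SimpleGame m where
  winning := {S | h < #S ∨ #S = h ∧ S ∈ F}
  isUpperSet_winning := by
    rintro S T hST (hS | ⟨hS, hSF⟩)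
    · exact Or.inl (hS.trans_le (card_le_card hST))
    · obtain rfl | hne := eq_or_ne S T
      · exact Or.inr ⟨hS, hSF⟩
      · exact Or.inl (hS ▸ card_lt_card (ssubset_of_ne_of_subset hne hST))
  empty_notMem := by simp [h_pos.ne]
  univ_mem := by simp [h_lt]

section Valuation

variable (hD : 0 ∈ D) (haD : a ∈ D) (ha : 0 < a)

lemma mul_val_univ_div_le_val_iff (U : SimpleGame m) {n : ℕ} (hc0 : 0 < c) (hcn : c ≤ n)
    (S : Finset (Fin m)) :
    c * (((U.valuation hD haD ha).val univ : ℝ) / n) ≤ ((U.valuation hD haD ha).val S : ℝ)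
      ↔ S ∈ U.winning := by
  have n_pos : (0 : ℝ) < n := hc0.trans_le hcn
  have : (0 : ℝ) < a := ha
  have share_le : c * ((a : ℝ) / n) ≤ a := by
    rw [mul_div_assoc', div_le_iff₀ n_pos, mul_comm]
    gcongr
  by_cases hS : S ∈ U.winning
  · simpa [valuation, U.univ_mem, hS] using share_le
  · simp only [valuation, if_pos U.univ_mem, hS, iff_false, not_le]
    positivity

lemma exists_isProp_iff (U U' : SimpleGame m) (hc0 : 0 < c) (hc2 : c ≤ 2) :
    (∃ A, IsProp c ![U.valuation hD haD ha, U'.valuation hD haD ha] A)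
      ↔ ∃ S ∈ U.winning, Sᶜ ∈ U'.winning := by
  have isProp_iff (A : Allocation 2 m) :
      IsProp c ![U.valuation hD haD ha, U'.valuation hD haD ha] A
        ↔ A.bundle 0 ∈ U.winning ∧ A.bundle 1 ∈ U'.winning := by
    rw [IsProp, Fin.forall_fin_two]
    exact and_congr (U.mul_val_univ_div_le_val_iff hD haD ha hc0 (by exact_mod_cast hc2) _)
      (U'.mul_val_univ_div_le_val_iff hD haD ha hc0 (by exact_mod_cast hc2) _)
  have bundle_one (A : Allocation 2 m) : A.bundle 1 = (A.bundle 0)ᶜ := by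
    ext g
    simp only [Allocation.bundle, mem_filter_univ, mem_compl]
    omega
  simp only [isProp_iff, bundle_one]
  refine ⟨fun ⟨A, hA⟩ => ⟨A.bundle 0, hA⟩, fun ⟨S, hS⟩ => ⟨fun g => if g ∈ S then 0 else 1, ?_⟩⟩
  convert hS <;> simp [Allocation.bundle]

end Valuation

lemma exists_mem_threshold_iff (h_pos : 0 < h) (h_lt : h < m) (h_pos' : 0 < m - h)
    (h_lt' : m - h < m) (F G : Set (Finset (Fin m))) :
    (∃ S ∈ (threshold h_pos h_lt F).winning, Sᶜ ∈ (threshold h_pos' h_lt' G).winning)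
      ↔ ∃ S ∈ F, #S = h ∧ Sᶜ ∈ G := by
  have card_compl_eq (S : Finset (Fin m)) : #Sᶜ = m - #S := by rw [card_compl, Fintype.card_fin]
  constructor
  · rintro ⟨S, hS | ⟨hS, hSF⟩, hS' | ⟨hS', hSG⟩⟩
    all_goals rw [card_compl_eq] at hS'
    · omega
    · omega
    · omega
    · exact ⟨S, hSF, hS, hSG⟩
  · rintro ⟨S, hSF, hS, hSG⟩
    exact ⟨S, Or.inr ⟨hS, hSF⟩, Or.inr ⟨by rw [card_compl_eq, hS], hSG⟩⟩

end SimpleGame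

section LowerBound

variable {m h : ℕ} {D : Set ℝ≥0} {c : ℝ}

theorem choose_le_mul_cost_of_computes_rightDecision (h_pos : 0 < h) (h_lt : h < m) (hc0 : 0 < c)
    (hc2 : c ≤ 2) (hD : 0 ∈ D) (hD' : ∃ a ∈ D, 0 < a)
    {Γ : RandomizedProtocol 2 (Valuation m D) Bool} (hΓ : Γ.Computes (RightDecision c)) :
    (m.choose h : ℕ∞) ≤ 288 * Γ.cost := by
  obtain ⟨a, haD, ha⟩ := hD'
  let ι := {S : Finset (Fin m) // #S = h}
  have card_ι : Fintype.card ι = m.choose h := by rw [Fintype.card_finset_len, Fintype.card_fin]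
  have : Nontrivial ι := by
    rw [← Fintype.one_lt_card_iff_nontrivial, card_ι]
    have := Nat.choose_pos h_lt.le
    have : m.choose h ≠ 1 := by rw [Ne, Nat.choose_eq_one_iff]; omega
    omega
  let V (x : ι → Bool) : Valuation m D :=
    (SimpleGame.threshold h_pos h_lt {S | ∃ hS : #S = h, x ⟨S, hS⟩ = true}).valuation hD haD ha
  let W (y : ι → Bool) : Valuation m D :=
    (SimpleGame.threshold (h := m - h) (by omega) (by omega)
      {S | ∃ hS : #Sᶜ = h, y ⟨Sᶜ, hS⟩ = true}).valuation hD haD ha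
  rw [← card_ι]
  refine hΓ.card_le_mul_cost_of_disjointness V W fun x y b hb => hb.trans ?_
  rw [SimpleGame.exists_isProp_iff hD haD ha _ _ hc0 hc2, SimpleGame.exists_mem_threshold_iff,
    not_disjoint_iff_exists]
  constructor
  · rintro ⟨S, ⟨hS, hx⟩, -, hS', hy⟩
    exact ⟨⟨S, hS⟩, hx, by simpa only [compl_compl] using hy⟩
  · rintro ⟨⟨S, hS⟩, hx, hy⟩
    exact ⟨S, ⟨hS, hx⟩, hS, by simpa only [Set.mem_ofPred_eq, compl_compl] using ⟨hS, hy⟩⟩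

end LowerBound

end FairDivision

theorem mainTheorem10_general :
    ∃ δ : ℝ≥0, 0 < δ ∧
      ∀ (c : ℝ) (m : ℕ) (D : Set ℝ≥0), 0 < c → c ≤ 2 → 2 ≤ m → 0 ∈ D → (∃ a ∈ D, 0 < a) →
        (∀ Γ : FairDivision.RandomizedProtocol 2 (FairDivision.Valuation m D) Bool,
          Γ.Computes (FairDivision.RightDecision c) →
            (δ : ℝ≥0∞) * (Nat.choose m (m / 2) : ℝ≥0∞) ≤ (Γ.cost : ℝ≥0∞)) ∧
        (δ : ℝ≥0∞) * (Nat.choose m (m / 2) : ℝ≥0∞) ≤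
          (FairDivision.randomizedComplexity D 2 m c : ℝ≥0∞) := by
  refine ⟨288⁻¹, by norm_num, fun c m D hc0 hc2 hm hD hD' => ?_⟩
  have decision_bound (Γ : FairDivision.RandomizedProtocol 2 (FairDivision.Valuation m D) Bool)
      (hΓ : Γ.Computes (FairDivision.RightDecision c)) :
      ((288⁻¹ : ℝ≥0) : ℝ≥0∞) * (m.choose (m / 2) : ℝ≥0∞) ≤ (Γ.cost : ℝ≥0∞) := by
    have choose_le := FairDivision.choose_le_mul_cost_of_computes_rightDecision
      (h := m / 2) (by omega) (by omega) hc0 hc2 hD hD' hΓ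
    rw [ENNReal.coe_inv (by norm_num), ENNReal.coe_ofNat,
      ENNReal.inv_mul_le_iff (by norm_num) (by norm_num)]
    have := ENat.toENNReal_le.2 choose_le
    rwa [ENat.toENNReal_mul, ENat.toENNReal_coe, ENat.toENNReal_ofNat] at this
  refine ⟨decision_bound, ?_⟩
  simp only [FairDivision.randomizedComplexity, ENat.toENNReal_iInf]
  refine le_iInf₂ fun Γ hΓ => ?_
  rw [← Γ.cost_toDecision]
  exact decision_bound _ hΓ.toDecision

theorem mainTheorem10 :
    ∃ δ : ℝ≥0, 0 < δ ∧
      ∀ (c : ℝ) (k : ℕ) (D : Set ℝ≥0), 0 < c → c ≤ 1 → 1 ≤ k → 0 ∈ D → 1 ∈ D →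
        (∀ Γ : FairDivision.RandomizedProtocol 2 (FairDivision.Valuation (2 * k) D) Bool,
          Γ.Computes (FairDivision.RightDecision c) →
            (δ : ℝ≥0∞) * (Nat.choose (2 * k) k : ℝ≥0∞) ≤ (Γ.cost : ℝ≥0∞)) ∧
        (δ : ℝ≥0∞) * (Nat.choose (2 * k) k : ℝ≥0∞) ≤
          (FairDivision.randomizedComplexity D 2 (2 * k) c : ℝ≥0∞) := by
  obtain ⟨δ, hδ, bounds⟩ := mainTheorem10_general
  refine ⟨δ, hδ, fun c k D hc0 hc1 hk h0 h1 => ?_⟩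
  simpa only [Nat.mul_div_cancel_left k two_pos] using
    bounds c (2 * k) D hc0 (by linarith) (by omega) h0 ⟨1, h1, one_pos⟩
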